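/- Let $p$ be an odd prime. All rings are commutative with $1$, $W_n$ denotes $p$-typical Witt vectors of length $n$, and $\Omega^1_A = \Omega^1_{A/\mathbb{Z}}$ denotes absolute Kähler differentials. For a ring $A$ let $W_\bullet\Omega^*_A$ be the ($p$-typical, absolute) de Rham–Witt complex of $A$, that is, the initial Witt complex over $A$. Here a Witt complex over $A$ consists of anticommutative non-negatively graded differential graded rings $E_n^*$ with restriction maps $R : E_{n+1}^* \to E_n^*$ of differential graded rings; ring homomorphisms $\lambda : W_n(A) \to E_n^0$ compatible with $R$; homomorphisms of graded rings $F : E_{n+1}^* \to E_n^*$ commuting with $R$, with $F\lambda = \lambda F$ and $F d\lambda([a]_{n+1}) = \lambda([a]_n)^{p-1} d\lambda([a]_n)$ for all $a \in A$; and additive degree-preserving maps $V : E_n^* \to E_{n+1}^*$ commuting with $R$, with $V\lambda = \lambda V$, $V(F(x)y) = xV(y)$, $FdV = d$ and $FV = p$. For $n \ge 1$ consider the sequence $$0 \to A \xrightarrow{(-d,\,p^n)} \Omega^1_A \oplus A \xrightarrow{V^n \oplus dV^n} W_{n+1}\Omega^1_A \xrightarrow{R} W_n\Omega^1_A \to 0,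 \qquad (*)$$ where $V^n \oplus dV^n$ sends $(\omega, a)$ to $V^n(\omega) + dV^n(a)$; here $A = W_1(A)$, and $\Omega^1_A$ is identified with $W_1\Omega^1_A$ through the canonical map $a\,db \mapsto \lambda(a)\,d\lambda(b)$. Let $A \subseteq B$ be $p$-torsion-free rings, and assume that 1. for all integers $n \ge 1$ we have $A \cap p^nB = p^nA$; 2. for all integers $n \ge 1$ the sequence $(*)$ is exact for $A$, and the corresponding sequence is exact for $B$; 3. the induced map $\Omega^1_A \to \Omega^1_B$ is injective. Then for all integers $n \ge 1$ the induced map $W_n\Omega^1_A \to W_n\Omega^1_B$ is injective. -/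

import Mathlib

open scoped KaehlerDifferential

universe u v w

noncomputable section

/-- A (`p`-typical) Witt complex over `A`, for an odd prime `p`.  The component of level `n` and
degree `k` is `E n k`.  The underlying pro-differential graded ring consists of the anticommutative
differential graded rings `E n *` and of the restriction maps `R`; it comes with a map `lam` from
the pro-ring of truncated Witt vectors `W_n(A)` to the degree zero part, with a Frobenius `F` (a
map of pro-graded rings) and with a Verschiebung `V` (a map of pro-graded modules, where the source
is a module through `F`).  Every element of `W_n(A)` is of the form `truncate n x`, so the laws
`F_lam` and `V_lam` describe `F` and `V` on the whole image of `lam`.  Level `0` is included for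
convenience: `W_0(A)` is the zero ring, so `E 0 k` is always zero. -/
structure WittComplex (p : ℕ) [Fact p.Prime] (A : Type u) [CommRing A] where
  E : ℕ → ℕ → Type w
  [addCommGroup : ∀ n k, AddCommGroup (E n k)]
  /- graded rings -/
  mul : ∀ {n i j k : ℕ}, i + j = k → E n i →+ E n j →+ E n k
  one : ∀ n, E n 0
  one_mul : ∀ {n k : ℕ} (x : E n k), mul (Nat.zero_add k) (one n) x = x
  mul_assoc : ∀ {n i j k a b l : ℕ} (h₁ : i + j = a) (h₂ : a + k = l) (h₃ : j + k = b)
    (h₄ : i + b = l) (x : E n i) (y : E n j) (z : E n k),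
    mul h₂ (mul h₁ x y) z = mul h₄ x (mul h₃ y z)
  mul_comm : ∀ {n i j k : ℕ} (h₁ : i + j = k) (h₂ : j + i = k) (x : E n i) (y : E n j),
    mul h₁ x y = (-1 : ℤ) ^ (i * j) • mul h₂ y x
  /- differential -/
  d : ∀ {n k : ℕ}, E n k →+ E n (k + 1)
  d_d : ∀ {n k : ℕ} (x : E n k), d (d x) = 0
  d_mul : ∀ {n i j k : ℕ} (h : i + j = k) (h₁ : (i + 1) + j = k + 1) (h₂ : i + (j + 1) = k + 1)
    (x : E n i) (y : E n j),
    d (mul h x y) = mul h₁ (d x) y + (-1 : ℤ) ^ i • mul h₂ x (d y)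
  /- restriction -/
  R : ∀ {n k : ℕ}, E (n + 1) k →+ E n k
  R_one : ∀ n, R (one (n + 1)) = one n
  R_mul : ∀ {n i j k : ℕ} (h : i + j = k) (x : E (n + 1) i) (y : E (n + 1) j),
    R (mul h x y) = mul h (R x) (R y)
  R_d : ∀ {n k : ℕ} (x : E (n + 1) k), R (d x) = d (R x)
  /- the map of pro-rings from the Witt vectors -/
  lam : ∀ n, TruncatedWittVector p n A →+ E n 0
  lam_one : ∀ n, lam n 1 = one n
  lam_mul : ∀ n (x y : TruncatedWittVector p n A),
    lam n (x * y) = mul (Nat.zero_add 0) (lam n x) (lam n y)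
  R_lam : ∀ n (x : TruncatedWittVector p (n + 1) A),
    R (lam (n + 1) x) = lam n (TruncatedWittVector.truncate n.le_succ x)
  /- Frobenius -/
  F : ∀ {n k : ℕ}, E (n + 1) k →+ E n k
  F_one : ∀ n, F (one (n + 1)) = one n
  F_mul : ∀ {n i j k : ℕ} (h : i + j = k) (x : E (n + 1) i) (y : E (n + 1) j),
    F (mul h x y) = mul h (F x) (F y)
  F_R : ∀ {n k : ℕ} (x : E (n + 1 + 1) k), F (R x) = R (F x)
  F_lam : ∀ n (x : WittVector p A),
    F (lam (n + 1) (WittVector.truncate (n + 1) x))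
      = lam n (WittVector.truncate n (WittVector.frobenius x))
  F_d_teichmuller : ∀ n (a : A),
    F (d (lam (n + 1) (WittVector.truncate (n + 1) (WittVector.teichmuller p a))))
      = mul (Nat.zero_add 1) (lam n (WittVector.truncate n (WittVector.teichmuller p a) ^ (p - 1)))
          (d (lam n (WittVector.truncate n (WittVector.teichmuller p a))))
  /- Verschiebung -/
  V : ∀ {n k : ℕ}, E n k →+ E (n + 1) k
  V_R : ∀ {n k : ℕ} (x : E (n + 1) k), V (R x) = R (V x)
  V_lam : ∀ n (x : WittVector p A),
    V (lam n (WittVector.truncate n x))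
      = lam (n + 1) (WittVector.truncate (n + 1) (WittVector.verschiebung x))
  V_F_mul : ∀ {n i j k : ℕ} (h : i + j = k) (x : E (n + 1) i) (y : E n j),
    V (mul h (F x) y) = mul h x (V y)
  F_d_V : ∀ {n k : ℕ} (x : E n k), F (d (V x)) = d x
  F_V : ∀ {n k : ℕ} (x : E n k), F (V x) = p • x

attribute [instance] WittComplex.addCommGroup

namespace WittComplex

variable {p : ℕ} [Fact p.Prime] {A : Type u} [CommRing A]

/-- Morphisms of Witt complexes over `A`. -/
@[ext]
structure Hom (E : WittComplex.{u, v} p A) (E' : WittComplex.{u, w} p A) where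
  toFun : ∀ n k, E.E n k →+ E'.E n k
  map_one : ∀ n, toFun n 0 (E.one n) = E'.one n
  map_mul : ∀ {n i j k : ℕ} (h : i + j = k) (x : E.E n i) (y : E.E n j),
    toFun n k (E.mul h x y) = E'.mul h (toFun n i x) (toFun n j y)
  map_d : ∀ {n k : ℕ} (x : E.E n k), toFun n (k + 1) (E.d x) = E'.d (toFun n k x)
  map_R : ∀ {n k : ℕ} (x : E.E (n + 1) k), toFun n k (E.R x) = E'.R (toFun (n + 1) k x)
  map_lam : ∀ n (x : TruncatedWittVector p n A), toFun n 0 (E.lam n x) = E'.lam n x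
  map_F : ∀ {n k : ℕ} (x : E.E (n + 1) k), toFun n k (E.F x) = E'.F (toFun (n + 1) k x)
  map_V : ∀ {n k : ℕ} (x : E.E n k), toFun (n + 1) k (E.V x) = E'.V (toFun n k x)

end WittComplex

/-! ### The de Rham-Witt complex, by generators and relations -/

namespace DeRhamWitt

section Construction

variable (p : ℕ) [Fact p.Prime] (A : Type u) [CommRing A]

/-- Formal expressions of level `n` and degree `k`. -/
inductive Pre : ℕ → ℕ → Type u
  | zero (n k : ℕ) : Pre n k
  | add {n k : ℕ} (x y : Pre n k) : Pre n k
  | neg {n k : ℕ} (x : Pre n k) : Pre n k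
  | mul {n i j k : ℕ} (h : i + j = k) (x : Pre n i) (y : Pre n j) : Pre n k
  | d {n k : ℕ} (x : Pre n k) : Pre n (k + 1)
  | R {n k : ℕ} (x : Pre (n + 1) k) : Pre n k
  | lam (n : ℕ) (x : TruncatedWittVector p n A) : Pre n 0
  | F {n k : ℕ} (x : Pre (n + 1) k) : Pre n k
  | V {n k : ℕ} (x : Pre n k) : Pre (n + 1) k

variable {p A}

/-- The formal expression `(-1) ^ m • x`. -/
def Pre.sign {n k : ℕ} (m : ℕ) (x : Pre p A n k) : Pre p A n k :=
  if Even m then x else x.neg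

/-- The formal expression `m • x`. -/
def Pre.nsmul {n k : ℕ} (m : ℕ) (x : Pre p A n k) : Pre p A n k :=
  m.rec (Pre.zero n k) (fun _ y => y.add x)

/-- The congruence generated by the laws of a Witt complex. -/
inductive Rel : ∀ {n k : ℕ}, Pre p A n k → Pre p A n k → Prop
  | refl {n k : ℕ} (x : Pre p A n k) : Rel x x
  | symm {n k : ℕ} {x y : Pre p A n k} : Rel x y → Rel y x
  | trans {n k : ℕ} {x y z : Pre p A n k} : Rel x y → Rel y z → Rel x z
  /- compatibility with the operations -/
  | congr_add {n k : ℕ} {x x' y y' : Pre p A n k} :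
      Rel x x' → Rel y y' → Rel (x.add y) (x'.add y')
  | congr_neg {n k : ℕ} {x x' : Pre p A n k} : Rel x x' → Rel x.neg x'.neg
  | congr_mul {n i j k : ℕ} (h : i + j = k) {x x' : Pre p A n i} {y y' : Pre p A n j} :
      Rel x x' → Rel y y' → Rel (Pre.mul h x y) (Pre.mul h x' y')
  | congr_d {n k : ℕ} {x x' : Pre p A n k} : Rel x x' → Rel x.d x'.d
  | congr_R {n k : ℕ} {x x' : Pre p A (n + 1) k} : Rel x x' → Rel x.R x'.R
  | congr_F {n k : ℕ} {x x' : Pre p A (n + 1) k} : Rel x x' → Rel x.F x'.F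
  | congr_V {n k : ℕ} {x x' : Pre p A n k} : Rel x x' → Rel x.V x'.V
  /- abelian groups -/
  | add_assoc {n k : ℕ} (x y z : Pre p A n k) : Rel ((x.add y).add z) (x.add (y.add z))
  | add_comm {n k : ℕ} (x y : Pre p A n k) : Rel (x.add y) (y.add x)
  | zero_add {n k : ℕ} (x : Pre p A n k) : Rel ((Pre.zero n k).add x) x
  | neg_add {n k : ℕ} (x : Pre p A n k) : Rel (x.neg.add x) (Pre.zero n k)
  /- additivity of the operations -/
  | mul_add {n i j k : ℕ} (h : i + j = k) (x : Pre p A n i) (y z : Pre p A n j) :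
      Rel (Pre.mul h x (y.add z)) ((Pre.mul h x y).add (Pre.mul h x z))
  | add_mul {n i j k : ℕ} (h : i + j = k) (x y : Pre p A n i) (z : Pre p A n j) :
      Rel (Pre.mul h (x.add y) z) ((Pre.mul h x z).add (Pre.mul h y z))
  | d_add {n k : ℕ} (x y : Pre p A n k) : Rel (x.add y).d (x.d.add y.d)
  | R_add {n k : ℕ} (x y : Pre p A (n + 1) k) : Rel (x.add y).R (x.R.add y.R)
  | F_add {n k : ℕ} (x y : Pre p A (n + 1) k) : Rel (x.add y).F (x.F.add y.F)
  | V_add {n k : ℕ} (x y : Pre p A n k) : Rel (x.add y).V (x.V.add y.V)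
  | lam_add (n : ℕ) (x y : TruncatedWittVector p n A) :
      Rel (Pre.lam n (x + y)) ((Pre.lam n x).add (Pre.lam n y))
  /- graded rings -/
  | one_mul {n k : ℕ} (x : Pre p A n k) : Rel (Pre.mul (Nat.zero_add k) (Pre.lam n 1) x) x
  | mul_assoc {n i j k a b l : ℕ} (h₁ : i + j = a) (h₂ : a + k = l) (h₃ : j + k = b)
      (h₄ : i + b = l) (x : Pre p A n i) (y : Pre p A n j) (z : Pre p A n k) :
      Rel (Pre.mul h₂ (Pre.mul h₁ x y) z) (Pre.mul h₄ x (Pre.mul h₃ y z))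
  | mul_comm {n i j k : ℕ} (h₁ : i + j = k) (h₂ : j + i = k) (x : Pre p A n i)
      (y : Pre p A n j) : Rel (Pre.mul h₁ x y) (Pre.sign (i * j) (Pre.mul h₂ y x))
  /- differential -/
  | d_d {n k : ℕ} (x : Pre p A n k) : Rel x.d.d (Pre.zero n (k + 1 + 1))
  | d_mul {n i j k : ℕ} (h : i + j = k) (h₁ : (i + 1) + j = k + 1) (h₂ : i + (j + 1) = k + 1)
      (x : Pre p A n i) (y : Pre p A n j) :
      Rel (Pre.mul h x y).d ((Pre.mul h₁ x.d y).add (Pre.sign i (Pre.mul h₂ x y.d)))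
  /- restriction -/
  | R_mul {n i j k : ℕ} (h : i + j = k) (x : Pre p A (n + 1) i) (y : Pre p A (n + 1) j) :
      Rel (Pre.mul h x y).R (Pre.mul h x.R y.R)
  | R_d {n k : ℕ} (x : Pre p A (n + 1) k) : Rel x.d.R x.R.d
  /- Witt vectors -/
  | lam_mul (n : ℕ) (x y : TruncatedWittVector p n A) :
      Rel (Pre.lam n (x * y)) (Pre.mul (Nat.zero_add 0) (Pre.lam n x) (Pre.lam n y))
  | R_lam (n : ℕ) (x : TruncatedWittVector p (n + 1) A) :
      Rel (Pre.lam (n + 1) x).R (Pre.lam n (TruncatedWittVector.truncate n.le_succ x))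
  /- Frobenius -/
  | F_mul {n i j k : ℕ} (h : i + j = k) (x : Pre p A (n + 1) i) (y : Pre p A (n + 1) j) :
      Rel (Pre.mul h x y).F (Pre.mul h x.F y.F)
  | F_R {n k : ℕ} (x : Pre p A (n + 1 + 1) k) : Rel x.R.F x.F.R
  | F_lam (n : ℕ) (x : WittVector p A) :
      Rel (Pre.lam (n + 1) (WittVector.truncate (n + 1) x)).F
        (Pre.lam n (WittVector.truncate n (WittVector.frobenius x)))
  | F_d_teichmuller (n : ℕ) (a : A) :
      Rel (Pre.lam (n + 1) (WittVector.truncate (n + 1) (WittVector.teichmuller p a))).d.F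
        (Pre.mul (Nat.zero_add 1)
          (Pre.lam n (WittVector.truncate n (WittVector.teichmuller p a) ^ (p - 1)))
          (Pre.lam n (WittVector.truncate n (WittVector.teichmuller p a))).d)
  /- Verschiebung -/
  | V_R {n k : ℕ} (x : Pre p A (n + 1) k) : Rel x.R.V x.V.R
  | V_lam (n : ℕ) (x : WittVector p A) :
      Rel (Pre.lam n (WittVector.truncate n x)).V
        (Pre.lam (n + 1) (WittVector.truncate (n + 1) (WittVector.verschiebung x)))
  | V_F_mul {n i j k : ℕ} (h : i + j = k) (x : Pre p A (n + 1) i) (y : Pre p A n j) :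
      Rel (Pre.mul h x.F y).V (Pre.mul h x y.V)
  | F_d_V {n k : ℕ} (x : Pre p A n k) : Rel x.V.d.F x.d
  | F_V {n k : ℕ} (x : Pre p A n k) : Rel x.V.F (Pre.nsmul p x)

variable (p A)

/-- The congruence `Rel` as a setoid. -/
def setoid (n k : ℕ) : Setoid (Pre p A n k) where
  r := Rel
  iseqv := ⟨Rel.refl, Rel.symm, Rel.trans⟩

/-- The group `W_nΩ^k_A`. -/
def Omega (n k : ℕ) : Type u := Quotient (setoid p A n k)

variable {p A}

/-- The class of a formal expression. -/
def cls {n k : ℕ} (x : Pre p A n k) : Omega p A n k := Quotient.mk (setoid p A n k) x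

theorem sound {n k : ℕ} {x y : Pre p A n k} (h : Rel x y) : cls x = cls y :=
  Quotient.sound (s := setoid p A n k) h

theorem cls_surj {n k : ℕ} (x : Omega p A n k) : ∃ y, cls y = x := Quotient.exists_rep x

instance (n k : ℕ) : Add (Omega p A n k) :=
  ⟨Quotient.map₂ Pre.add fun _ _ h _ _ h' => Rel.congr_add h h'⟩

instance (n k : ℕ) : Zero (Omega p A n k) := ⟨cls (Pre.zero n k)⟩

instance (n k : ℕ) : Neg (Omega p A n k) := ⟨Quotient.map Pre.neg fun _ _ h => Rel.congr_neg h⟩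

instance (n k : ℕ) : AddCommGroup (Omega p A n k) where
  add_assoc := by
    rintro ⟨x⟩ ⟨y⟩ ⟨z⟩
    exact sound (Rel.add_assoc x y z)
  add_comm := by
    rintro ⟨x⟩ ⟨y⟩
    exact sound (Rel.add_comm x y)
  zero_add := by
    rintro ⟨x⟩
    exact sound (Rel.zero_add x)
  add_zero := by
    rintro ⟨x⟩
    exact sound ((Rel.add_comm _ _).trans (Rel.zero_add x))
  neg_add_cancel := by
    rintro ⟨x⟩
    exact sound (Rel.neg_add x)
  nsmul := nsmulRec
  zsmul := zsmulRec

theorem cls_add {n k : ℕ} (x y : Pre p A n k) : cls (x.add y) = cls x + cls y := rfl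

theorem cls_zero (n k : ℕ) : cls (Pre.zero n k : Pre p A n k) = 0 := rfl

theorem cls_neg {n k : ℕ} (x : Pre p A n k) : cls x.neg = -cls x := rfl

theorem cls_sign {n k : ℕ} (m : ℕ) (x : Pre p A n k) :
    cls (Pre.sign m x) = (-1 : ℤ) ^ m • cls x := by
  unfold Pre.sign
  split_ifs with h
  · rw [h.neg_one_pow, one_smul]
  · rw [(Nat.not_even_iff_odd.mp h).neg_one_pow, neg_smul, one_smul, cls_neg]

theorem cls_nsmul {n k : ℕ} (m : ℕ) (x : Pre p A n k) :
    cls (Pre.nsmul m x) = m • cls x := by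
  induction m with
  | zero => rw [zero_smul]; rfl
  | succ m ih => rw [succ_nsmul, ← ih]; rfl

variable (p A)

end Construction

end DeRhamWitt

/-- The de Rham-Witt complex of `A`, constructed as the Witt complex over `A` that is
presented by the generators `lam n x`, subject only to the laws of a Witt complex; it is the initial
Witt complex over `A`, see `deRhamWitt_initial`. -/
def deRhamWitt (p : ℕ) [Fact p.Prime] (A : Type u) [CommRing A] : WittComplex.{u, u} p A where
  E := DeRhamWitt.Omega p A
  mul := fun h => AddMonoidHom.mk' (fun x => AddMonoidHom.mk'
      (fun y => Quotient.map₂ (DeRhamWitt.Pre.mul h)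
        (fun _ _ h₁ _ _ h₂ => DeRhamWitt.Rel.congr_mul h h₁ h₂) x y)
      (by
        rintro ⟨y⟩ ⟨z⟩
        induction x using Quotient.inductionOn with | _ x
        exact DeRhamWitt.sound (DeRhamWitt.Rel.mul_add h x y z)))
      (by
        rintro ⟨x⟩ ⟨y⟩
        ext ⟨z⟩
        exact DeRhamWitt.sound (DeRhamWitt.Rel.add_mul h x y z))
  one := fun n => DeRhamWitt.cls (.lam n 1)
  one_mul := by
    rintro n k ⟨x⟩
    exact DeRhamWitt.sound (.one_mul x)
  mul_assoc := by
    rintro n i j k a b l h₁ h₂ h₃ h₄ ⟨x⟩ ⟨y⟩ ⟨z⟩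
    exact DeRhamWitt.sound (.mul_assoc h₁ h₂ h₃ h₄ x y z)
  mul_comm := by
    rintro n i j k h₁ h₂ ⟨x⟩ ⟨y⟩
    exact (DeRhamWitt.sound (.mul_comm h₁ h₂ x y)).trans (DeRhamWitt.cls_sign _ _)
  d := AddMonoidHom.mk' (Quotient.map DeRhamWitt.Pre.d fun _ _ h => .congr_d h) (by
    rintro ⟨x⟩ ⟨y⟩
    exact DeRhamWitt.sound (.d_add x y))
  d_d := by
    rintro n k ⟨x⟩
    exact DeRhamWitt.sound (.d_d x)
  d_mul := by
    rintro n i j k h h₁ h₂ ⟨x⟩ ⟨y⟩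
    refine (DeRhamWitt.sound (.d_mul h h₁ h₂ x y)).trans ?_
    rw [DeRhamWitt.cls_add, DeRhamWitt.cls_sign]
    rfl
  R := AddMonoidHom.mk' (Quotient.map DeRhamWitt.Pre.R fun _ _ h => .congr_R h) (by
    rintro ⟨x⟩ ⟨y⟩
    exact DeRhamWitt.sound (.R_add x y))
  R_one := fun n => by
    refine (DeRhamWitt.sound (.R_lam n 1)).trans ?_
    rw [map_one]
  R_mul := by
    rintro n i j k h ⟨x⟩ ⟨y⟩
    exact DeRhamWitt.sound (.R_mul h x y)
  R_d := by
    rintro n k ⟨x⟩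
    exact DeRhamWitt.sound (.R_d x)
  lam := fun n => AddMonoidHom.mk' (fun x => DeRhamWitt.cls (.lam n x))
    (fun x y => DeRhamWitt.sound (.lam_add n x y))
  lam_one := fun _ => rfl
  lam_mul := fun n x y => DeRhamWitt.sound (.lam_mul n x y)
  R_lam := fun n x => DeRhamWitt.sound (.R_lam n x)
  F := AddMonoidHom.mk' (Quotient.map DeRhamWitt.Pre.F fun _ _ h => .congr_F h) (by
    rintro ⟨x⟩ ⟨y⟩
    exact DeRhamWitt.sound (.F_add x y))
  F_one := fun n => by
    have h := DeRhamWitt.sound (DeRhamWitt.Rel.F_lam (p := p) (A := A) n 1)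
    simp only [map_one] at h
    exact h
  F_mul := by
    rintro n i j k h ⟨x⟩ ⟨y⟩
    exact DeRhamWitt.sound (.F_mul h x y)
  F_R := by
    rintro n k ⟨x⟩
    exact DeRhamWitt.sound (.F_R x)
  F_lam := fun n x => DeRhamWitt.sound (.F_lam n x)
  F_d_teichmuller := fun n a => DeRhamWitt.sound (.F_d_teichmuller n a)
  V := AddMonoidHom.mk' (Quotient.map DeRhamWitt.Pre.V fun _ _ h => .congr_V h) (by
    rintro ⟨x⟩ ⟨y⟩
    exact DeRhamWitt.sound (.V_add x y))
  V_R := by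
    rintro n k ⟨x⟩
    exact DeRhamWitt.sound (.V_R x)
  V_lam := fun n x => DeRhamWitt.sound (.V_lam n x)
  V_F_mul := by
    rintro n i j k h ⟨x⟩ ⟨y⟩
    exact DeRhamWitt.sound (.V_F_mul h x y)
  F_d_V := by
    rintro n k ⟨x⟩
    exact DeRhamWitt.sound (.F_d_V x)
  F_V := by
    rintro n k ⟨x⟩
    exact (DeRhamWitt.sound (.F_V x)).trans (DeRhamWitt.cls_nsmul _ _)

/-! ### The universal property -/

namespace DeRhamWitt

section Initial

variable {p : ℕ} [Fact p.Prime] {A : Type u} [CommRing A] (E : WittComplex.{u, w} p A)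

/-- The value of a formal expression in a Witt complex. -/
def eval : ∀ {n k : ℕ}, Pre p A n k → E.E n k
  | _, _, .zero _ _ => 0
  | _, _, .add x y => eval x + eval y
  | _, _, .neg x => -eval x
  | _, _, .mul h x y => E.mul h (eval x) (eval y)
  | _, _, .d x => E.d (eval x)
  | _, _, .R x => E.R (eval x)
  | _, _, .lam n x => E.lam n x
  | _, _, .F x => E.F (eval x)
  | _, _, .V x => E.V (eval x)

theorem eval_sign {n k : ℕ} (m : ℕ) (x : Pre p A n k) :
    eval E (Pre.sign m x) = (-1 : ℤ) ^ m • eval E x := by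
  unfold Pre.sign
  split_ifs with h
  · rw [h.neg_one_pow, one_smul]
  · rw [(Nat.not_even_iff_odd.mp h).neg_one_pow, neg_smul, one_smul, eval]

theorem eval_nsmul {n k : ℕ} (m : ℕ) (x : Pre p A n k) :
    eval E (Pre.nsmul m x) = m • eval E x := by
  induction m with
  | zero => rw [zero_smul]; simp [Pre.nsmul, eval]
  | succ m ih => rw [succ_nsmul, ← ih]; simp [Pre.nsmul, eval]

theorem eval_rel {n k : ℕ} {x y : Pre p A n k} (h : Rel x y) : eval E x = eval E y := by
  induction h with
  | refl x => rfl
  | symm _ ih => exact ih.symm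
  | trans _ _ ih₁ ih₂ => exact ih₁.trans ih₂
  | congr_add _ _ ih₁ ih₂ => simp only [eval, ih₁, ih₂]
  | congr_neg _ ih => simp only [eval, ih]
  | congr_mul h _ _ ih₁ ih₂ => simp only [eval, ih₁, ih₂]
  | congr_d _ ih => simp only [eval, ih]
  | congr_R _ ih => simp only [eval, ih]
  | congr_F _ ih => simp only [eval, ih]
  | congr_V _ ih => simp only [eval, ih]
  | add_assoc x y z => simp only [eval, _root_.add_assoc]
  | add_comm x y => simp only [eval, _root_.add_comm]
  | zero_add x => simp only [eval, _root_.zero_add]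
  | neg_add x => simp only [eval, neg_add_cancel]
  | mul_add h x y z => simp only [eval, map_add]
  | add_mul h x y z => simp only [eval, map_add, AddMonoidHom.add_apply]
  | d_add x y => simp only [eval, map_add]
  | R_add x y => simp only [eval, map_add]
  | F_add x y => simp only [eval, map_add]
  | V_add x y => simp only [eval, map_add]
  | lam_add n x y => simp only [eval, map_add]
  | one_mul x => simp only [eval, E.lam_one, E.one_mul]
  | mul_assoc h₁ h₂ h₃ h₄ x y z => simp only [eval, E.mul_assoc h₁ h₂ h₃ h₄]
  | mul_comm h₁ h₂ x y => rw [eval_sign]; simp only [eval]; exact E.mul_comm h₁ h₂ _ _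
  | d_d x => simp only [eval, E.d_d]
  | d_mul h h₁ h₂ x y =>
    rw [eval, eval, eval, eval_sign]; simp only [eval]; exact E.d_mul h h₁ h₂ _ _
  | R_mul h x y => simp only [eval, E.R_mul]
  | R_d x => simp only [eval, E.R_d]
  | lam_mul n x y => simp only [eval, E.lam_mul]
  | R_lam n x => simp only [eval, E.R_lam]
  | F_mul h x y => simp only [eval, E.F_mul]
  | F_R x => simp only [eval, E.F_R]
  | F_lam n x => simp only [eval, E.F_lam]
  | F_d_teichmuller n a => simp only [eval, E.F_d_teichmuller]
  | V_R x => simp only [eval, E.V_R]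
  | V_lam n x => simp only [eval, E.V_lam]
  | V_F_mul h x y => simp only [eval, E.V_F_mul]
  | F_d_V x => simp only [eval, E.F_d_V]
  | F_V x => rw [eval_nsmul]; simp only [eval, E.F_V]

/-- The canonical morphism from the de Rham-Witt complex to a Witt complex. -/
def lift : (deRhamWitt p A).Hom E where
  toFun := fun n k => AddMonoidHom.mk'
    (Quotient.lift (s := setoid p A n k) (eval E) fun _ _ h => eval_rel E h) (by
      rintro ⟨x⟩ ⟨y⟩
      change eval E (x.add y) = eval E x + eval E y
      rw [eval])
  map_one := fun n => by
    change eval E (.lam n 1) = _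
    rw [eval, E.lam_one]
  map_mul := by
    rintro n i j k h ⟨x⟩ ⟨y⟩
    change eval E (.mul h x y) = E.mul h (eval E x) (eval E y)
    rw [eval]
  map_d := by
    rintro n k ⟨x⟩
    change eval E x.d = E.d (eval E x)
    rw [eval]
  map_R := by
    rintro n k ⟨x⟩
    change eval E x.R = E.R (eval E x)
    rw [eval]
  map_lam := fun n x => by
    change eval E (.lam n x) = _
    rw [eval]
  map_F := by
    rintro n k ⟨x⟩
    change eval E x.F = E.F (eval E x)
    rw [eval]
  map_V := by
    rintro n k ⟨x⟩
    change eval E x.V = E.V (eval E x)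
    rw [eval]

theorem hom_cls (f : (deRhamWitt p A).Hom E) {n k : ℕ} (x : Pre p A n k) :
    f.toFun n k (cls x) = eval E x := by
  induction x with
  | zero n k => rw [eval]; exact map_zero (f.toFun n k)
  | add x y ihx ihy => rw [eval, ← ihx, ← ihy]; exact map_add (f.toFun _ _) (cls x) (cls y)
  | neg x ih => rw [eval, ← ih]; exact map_neg (f.toFun _ _) (cls x)
  | mul h x y ihx ihy => rw [eval, ← ihx, ← ihy]; exact f.map_mul h (cls x) (cls y)
  | d x ih => rw [eval, ← ih]; exact f.map_d (cls x)
  | R x ih => rw [eval, ← ih]; exact f.map_R (cls x)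
  | lam n x => rw [eval]; exact f.map_lam n x
  | F x ih => rw [eval, ← ih]; exact f.map_F (cls x)
  | V x ih => rw [eval, ← ih]; exact f.map_V (cls x)

end Initial

end DeRhamWitt

/-- `deRhamWitt p A` is the initial Witt complex over `A`. -/
theorem deRhamWitt_initial {p : ℕ} [Fact p.Prime] {A : Type u} [CommRing A]
    (E : WittComplex.{u, w} p A) : ∃! _f : (deRhamWitt p A).Hom E, True := by
  refine ⟨DeRhamWitt.lift E, trivial, fun f _ => ?_⟩
  ext n k x
  obtain ⟨y, rfl⟩ := DeRhamWitt.cls_surj x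
  rw [DeRhamWitt.hom_cls E f, DeRhamWitt.hom_cls E (DeRhamWitt.lift E)]

/-! ### Functoriality -/

section Functoriality

variable (p : ℕ) [Fact p.Prime] (A : Type u) [CommRing A] (B : Type v) [CommRing B] [Algebra A B]

/-- The ring homomorphism `W_n(A) → W_n(B)` induced by `A → B`. -/
def truncatedWittMap (n : ℕ) : TruncatedWittVector p n A →+* TruncatedWittVector p n B :=
  RingHom.liftOfSurjective (WittVector.truncate n : WittVector p A →+* _)
    (WittVector.truncate_surjective p n A)
    ⟨(WittVector.truncate n).comp (WittVector.map (algebraMap A B)), fun x hx => by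
      rw [WittVector.mem_ker_truncate] at hx
      rw [RingHom.mem_ker, RingHom.comp_apply, ← RingHom.mem_ker, WittVector.mem_ker_truncate]
      intro i hi
      rw [WittVector.map_coeff, hx i hi, map_zero]⟩

theorem truncatedWittMap_truncate (n : ℕ) (x : WittVector p A) :
    truncatedWittMap p A B n (WittVector.truncate n x)
      = WittVector.truncate n (WittVector.map (algebraMap A B) x) :=
  RingHom.liftOfRightInverse_comp_apply _ _ _ _ x

theorem wittMap_frobenius (x : WittVector p A) :
    WittVector.map (algebraMap A B) (WittVector.frobenius x)
      = WittVector.frobenius (WittVector.map (algebraMap A B) x) := by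
  ext n
  rw [WittVector.map_coeff, WittVector.coeff_frobenius, WittVector.coeff_frobenius,
    MvPolynomial.aeval_def, MvPolynomial.aeval_def, MvPolynomial.hom_eval₂,
    RingHom.ext_int ((algebraMap A B).comp (algebraMap ℤ A)) (algebraMap ℤ B)]
  rfl

variable {p B}

/-- A Witt complex over an `A`-algebra `B`, viewed as a Witt complex over `A`. -/
def WittComplex.restrict (E : WittComplex.{v, w} p B) : WittComplex.{u, w} p A :=
  { E with
    lam := fun n => (E.lam n).comp (truncatedWittMap p A B n).toAddMonoidHom
    lam_one := fun n => by simp [E.lam_one]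
    lam_mul := fun n x y => by simp [E.lam_mul]
    R_lam := fun n x => by
      obtain ⟨x, rfl⟩ := WittVector.truncate_surjective p (n + 1) A x
      simp [E.R_lam, truncatedWittMap_truncate, TruncatedWittVector.truncate_wittVector_truncate]
    F_lam := fun n x => by
      simp [E.F_lam, truncatedWittMap_truncate, wittMap_frobenius]
    F_d_teichmuller := fun n a => by
      have h := E.F_d_teichmuller n (algebraMap A B a)
      simpa [truncatedWittMap_truncate, WittVector.map_teichmuller] using h
    V_lam := fun n x => by
      simp [E.V_lam, truncatedWittMap_truncate, WittVector.map_verschiebung] }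

variable (p B)

/-- The map `W_nΩ^k_A → W_nΩ^k_B` induced by `A → B`. -/
def deRhamWittMap (n k : ℕ) : (deRhamWitt p A).E n k →+ (deRhamWitt p B).E n k :=
  (DeRhamWitt.lift ((deRhamWitt p B).restrict A)).toFun n k

end Functoriality

/-! ### The exact sequence -/

section Sequence

variable (p : ℕ) [Fact p.Prime] (A : Type u) [CommRing A]

/-- The canonical identification of `A` with `W_1(A)`. -/
def wittOne : A →+* TruncatedWittVector p 1 A where
  toFun a := WittVector.truncate 1 (WittVector.teichmuller p a)
  map_one' := by simp
  map_mul' a b := by simp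
  map_zero' := by simp
  map_add' a b := by
    rw [← map_add]
    ext i
    rw [WittVector.coeff_truncate, WittVector.coeff_truncate]
    obtain rfl : i = 0 := Subsingleton.elim _ _
    simp [WittVector.add_coeff_zero]

theorem wittOne_bijective : Function.Bijective (wittOne p A) := by
  constructor
  · intro a b h
    have := congrArg (TruncatedWittVector.coeff 0) h
    simpa [wittOne] using this
  · intro x
    refine ⟨x.coeff 0, ?_⟩
    ext i
    obtain rfl : i = 0 := Subsingleton.elim _ _
    simp [wittOne]

variable {p A}

/-- Level `1` and degree `1` of a Witt complex over `A`, as an `A`-module through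
`A = W_1(A) → E 1 0`. -/
abbrev WittComplex.moduleOne (E : WittComplex.{u, w} p A) : Module A (E.E 1 1) where
  smul a x := E.mul (Nat.zero_add 1) (E.lam 1 (wittOne p A a)) x
  one_smul x := by
    change E.mul _ (E.lam 1 (wittOne p A 1)) x = x
    rw [map_one, E.lam_one, E.one_mul]
  mul_smul a b x := by
    change E.mul _ (E.lam 1 (wittOne p A (a * b))) x = E.mul _ _ (E.mul _ _ x)
    rw [map_mul, E.lam_mul, E.mul_assoc]
  smul_zero a := map_zero _
  smul_add a x y := map_add _ _ _
  add_smul a b x := by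
    change E.mul _ (E.lam 1 (wittOne p A (a + b))) x = E.mul _ _ x + E.mul _ _ x
    rw [map_add, map_add, map_add, AddMonoidHom.add_apply]
  zero_smul x := by
    change E.mul _ (E.lam 1 (wittOne p A 0)) x = 0
    rw [map_zero, map_zero, map_zero, AddMonoidHom.zero_apply]

/-- The canonical map `Ω^1_A → E 1 1`, which sends `a db` to `lam a • d (lam b)`.  For the
de Rham-Witt complex this is the identification of `Ω^1_A` with `W_1Ω^1_A`. -/
def WittComplex.ofKaehler (E : WittComplex.{u, w} p A) : Ω[A⁄ℤ] →+ E.E 1 1 :=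
  letI := E.moduleOne
  (Derivation.liftKaehlerDifferential (Derivation.mk'
    ((E.d.comp ((E.lam 1).comp (wittOne p A).toAddMonoidHom)).toIntLinearMap) (fun a b => by
      change E.d (E.lam 1 (wittOne p A (a * b)))
        = E.mul (Nat.zero_add 1) (E.lam 1 (wittOne p A a)) (E.d (E.lam 1 (wittOne p A b)))
          + E.mul (Nat.zero_add 1) (E.lam 1 (wittOne p A b)) (E.d (E.lam 1 (wittOne p A a)))
      have h := E.mul_comm (Nat.add_zero 1) (Nat.zero_add 1) (E.d (E.lam 1 (wittOne p A a)))
        (E.lam 1 (wittOne p A b))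
      rw [mul_zero, pow_zero, one_smul] at h
      rw [map_mul, E.lam_mul, E.d_mul _ (Nat.add_zero 1) (Nat.zero_add 1), pow_zero, one_smul, h]
      exact add_comm _ _))).toAddMonoidHom

/-- The iterated Verschiebung `V^n` from level `1` to level `n + 1`. -/
def WittComplex.iterV (E : WittComplex.{u, w} p A) (k : ℕ) : ∀ n : ℕ, E.E 1 k →+ E.E (n + 1) k
  | 0 => AddMonoidHom.id _
  | n + 1 => E.V.comp (E.iterV k n)

variable (p A)

/-- The map `(-d, p^n) : A → Ω^1_A ⊕ A`. -/
def seqLeft (n : ℕ) : A →+ Ω[A⁄ℤ] × A :=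
  (-(KaehlerDifferential.D ℤ A).toLinearMap.toAddMonoidHom).prod
    (AddMonoidHom.mulLeft ((p : A) ^ n))

/-- The map `V^n ⊕ dV^n : Ω^1_A ⊕ A → W_{n+1}Ω^1_A`. -/
def seqMiddle (n : ℕ) : Ω[A⁄ℤ] × A →+ (deRhamWitt p A).E (n + 1) 1 :=
  (((deRhamWitt p A).iterV 1 n).comp (deRhamWitt p A).ofKaehler).coprod
    ((deRhamWitt p A).d.comp (((deRhamWitt p A).iterV 0 n).comp
      (((deRhamWitt p A).lam 1).comp (wittOne p A).toAddMonoidHom)))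

/-- Exactness of
`0 → A → Ω^1_A ⊕ A → W_{n+1}Ω^1_A → W_nΩ^1_A → 0`,
where the maps are `(-d, p^n)`, `V^n ⊕ dV^n` and the restriction `R`. -/
structure SequenceExact (n : ℕ) : Prop where
  injective : Function.Injective (seqLeft p A n)
  exact_left : Function.Exact (seqLeft p A n) (seqMiddle p A n)
  exact_right : Function.Exact (seqMiddle p A n)
    ((deRhamWitt p A).R : (deRhamWitt p A).E (n + 1) 1 →+ (deRhamWitt p A).E n 1)
  surjective : Function.Surjective
    ((deRhamWitt p A).R : (deRhamWitt p A).E (n + 1) 1 →+ (deRhamWitt p A).E n 1)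

end Sequence

end

/-! Induction on `n`, by a diagram chase between the two exact sequences.

Length one: the identification of `Ω¹` with `W₁Ω¹` reduces the claim to injectivity of `Ω¹_A →
Ω¹_B`. Since the complex is presented by generators and relations, the identification needs proof.
Surjectivity (`ofKaehler_surjective`, used for `A`) holds because every element of degree one is a
sum of terms `lam x * d (lam y)`. Injectivity (`ofKaehler_injective`, used for `B`) is read off from
the exact sequence, as `p` is not a zero divisor.

From `n` to `n + 1`: let `x` die over `B`. By induction `R x = 0`, so `x = V^n ω + dV^n a`. Over `B`
exactness makes the image of `(ω, a)` equal to `(-db, p^n b)` for some `b`. Since `A ∩ p^n B = p^n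
A`, `a = p^n c` with `c` in `A`, and torsion-freeness of `B` gives `b = c`. Then `ω` and `-dc` agree
in `Ω¹_B`, hence in `Ω¹_A`. So `(ω, a)` comes from `c`, and `x = 0`. -/

theorem eq_zero_of_pow_mul_eq_zero {M : Type*} [MonoidWithZero M] {x : M}
    (hx : ∀ a : M, x * a = 0 → a = 0) (n : ℕ) {a : M} (h : x ^ n * a = 0) : a = 0 := by
  induction n with
  | zero => simpa using h
  | succ n ih => exact ih (hx _ (by rw [← mul_assoc, ← pow_succ', h]))

theorem seqLeft_apply (p : ℕ) (A : Type u) [CommRing A] (n : ℕ) (a : A) :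
    seqLeft p A n a = (-KaehlerDifferential.D ℤ A a, (p : A) ^ n * a) := rfl

/-! ### Stability of the sums of terms `lam x * d (lam y)` in a Witt complex -/

namespace WittComplex

variable {p : ℕ} [Fact p.Prime] {A : Type u} [CommRing A]

/-- The subgroup of `E n 1` generated by the elements `lam x * d (lam y)`. -/
def lamDLam (E : WittComplex.{u, w} p A) (n : ℕ) : AddSubgroup (E.E n 1) :=
  AddSubgroup.closure
    {z | ∃ x y, z = E.mul (Nat.zero_add 1) (E.lam n x) (E.d (E.lam n y))}

/-- The elements of degree `0` that are in the image of `lam`, and those of degree `1` that are sums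
of elements `lam x * d (lam y)`; there is no condition in higher degrees. -/
def IsLamDLam (E : WittComplex.{u, w} p A) (n : ℕ) : ∀ k, E.E n k → Prop
  | 0, z => z ∈ (E.lam n).range
  | 1, z => z ∈ E.lamDLam n
  | _ + 2, _ => True

variable (E : WittComplex.{u, w} p A)

theorem mul_d_mem_lamDLam {n : ℕ} (h : 0 + 1 = 1) (x y : TruncatedWittVector p n A) :
    E.mul h (E.lam n x) (E.d (E.lam n y)) ∈ E.lamDLam n :=
  AddSubgroup.subset_closure ⟨x, y, rfl⟩

theorem d_lam_mem_lamDLam {n : ℕ} (y : TruncatedWittVector p n A) :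
    E.d (E.lam n y) ∈ E.lamDLam n := by
  rw [← E.one_mul (E.d (E.lam n y)), ← E.lam_one]
  exact E.mul_d_mem_lamDLam _ 1 y

/-- Additive maps can be tested on generators; this reduces stability under `R`, `F`, `V` and
multiplication by `lam x` to one computation each. -/
theorem lamDLam_le_comap {n m : ℕ} (f : E.E n 1 →+ E.E m 1)
    (hf : ∀ x y, f (E.mul (Nat.zero_add 1) (E.lam n x) (E.d (E.lam n y))) ∈ E.lamDLam m)
    {z : E.E n 1} (hz : z ∈ E.lamDLam n) : f z ∈ E.lamDLam m := by
  refine (AddSubgroup.closure_le ((E.lamDLam m).comap f)).2 ?_ hz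
  rintro _ ⟨x, y, rfl⟩
  exact hf x y

theorem lam_mul_mem_lamDLam {n : ℕ} (h : 0 + 1 = 1) (x : TruncatedWittVector p n A)
    {z : E.E n 1} (hz : z ∈ E.lamDLam n) : E.mul h (E.lam n x) z ∈ E.lamDLam n := by
  refine E.lamDLam_le_comap (E.mul h (E.lam n x)) (fun y t => ?_) hz
  rw [← E.mul_assoc (Nat.zero_add 0) h, ← E.lam_mul]
  exact E.mul_d_mem_lamDLam _ _ _

theorem IsLamDLam.add {n k : ℕ} {x y : E.E n k} (hx : E.IsLamDLam n k x)
    (hy : E.IsLamDLam n k y) : E.IsLamDLam n k (x + y) :=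
  match k with
  | 0 => add_mem (S := AddSubgroup _) hx hy
  | 1 => add_mem (S := AddSubgroup _) hx hy
  | _ + 2 => trivial

theorem IsLamDLam.neg {n k : ℕ} {x : E.E n k} (hx : E.IsLamDLam n k x) :
    E.IsLamDLam n k (-x) :=
  match k with
  | 0 => neg_mem (S := AddSubgroup _) hx
  | 1 => neg_mem (S := AddSubgroup _) hx
  | _ + 2 => trivial

theorem isLamDLam_zero (n k : ℕ) : E.IsLamDLam n k 0 :=
  match k with
  | 0 => zero_mem (E.lam n).range
  | 1 => zero_mem (E.lamDLam n)
  | _ + 2 => trivial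

/-- In a product of degree one, one factor has degree zero and so lies in the image of `lam`; moving
it to the left costs no sign. -/
theorem IsLamDLam.mul {n i j k : ℕ} (h : i + j = k) {x : E.E n i} {y : E.E n j}
    (hx : E.IsLamDLam n i x) (hy : E.IsLamDLam n j y) : E.IsLamDLam n k (E.mul h x y) := by
  match k, i, j with
  | 0, 0, 0 =>
    obtain ⟨x, rfl⟩ := hx
    obtain ⟨y, rfl⟩ := hy
    exact ⟨x * y, E.lam_mul n x y⟩
  | 1, 0, 1 =>
    obtain ⟨x, rfl⟩ := hx
    exact E.lam_mul_mem_lamDLam h x hy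
  | 1, 1, 0 =>
    obtain ⟨y, rfl⟩ := hy
    rw [E.mul_comm h (Nat.zero_add 1), Nat.mul_zero, pow_zero, one_smul]
    exact E.lam_mul_mem_lamDLam _ y hx
  | _ + 2, _, _ => trivial
  | 0, _ + 1, _ => omega
  | 0, 0, _ + 1 => omega
  | 1, 0, 0 => omega
  | 1, 0, _ + 2 => omega
  | 1, 1, _ + 1 => omega
  | 1, _ + 2, _ => omega

theorem IsLamDLam.d {n k : ℕ} {x : E.E n k} (hx : E.IsLamDLam n k x) :
    E.IsLamDLam n (k + 1) (E.d x) := by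
  match k with
  | 0 =>
    obtain ⟨x, rfl⟩ := hx
    exact E.d_lam_mem_lamDLam x
  | _ + 1 => trivial

theorem IsLamDLam.R {n k : ℕ} {x : E.E (n + 1) k} (hx : E.IsLamDLam (n + 1) k x) :
    E.IsLamDLam n k (E.R x) := by
  match k with
  | 0 =>
    obtain ⟨x, rfl⟩ := hx
    exact ⟨_, (E.R_lam n x).symm⟩
  | 1 =>
    refine E.lamDLam_le_comap E.R (fun x y => ?_) hx
    rw [E.R_mul, E.R_d, E.R_lam, E.R_lam]
    exact E.mul_d_mem_lamDLam _ _ _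
  | _ + 2 => trivial

/-- A truncated Witt vector is the sum of a Teichmüller representative and a Verschiebung. -/
theorem _root_.WittVector.eq_teichmuller_add_verschiebung (x : WittVector p A) :
    ∃ y : WittVector p A,
      x = WittVector.teichmuller p (x.coeff 0) + WittVector.verschiebung y := by
  refine ⟨(x - WittVector.teichmuller p (x.coeff 0)).shift 1, ?_⟩
  rw [← sub_eq_iff_eq_add']
  refine (WittVector.eq_iterate_verschiebung (n := 1) fun i hi => ?_)
  obtain rfl : i = 0 := by omega
  -- The coefficient of index `0` is a ring homomorphism, so it can be computed on the difference
  -- termwise.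
  have h : WittVector.constantCoeff (x - WittVector.teichmuller p (x.coeff 0)) = 0 := by
    rw [map_sub]
    simp [WittVector.constantCoeff]
  exact h

/-- The laws give `F d` on Teichmüller representatives and, through `F d V = d`, on Verschiebungen.
Every Witt vector is a sum of one of each. -/
theorem F_d_lam_mem_lamDLam {n : ℕ} (y : TruncatedWittVector p (n + 1) A) :
    E.F (E.d (E.lam (n + 1) y)) ∈ E.lamDLam n := by
  obtain ⟨y, rfl⟩ := WittVector.truncate_surjective p (n + 1) A y
  obtain ⟨z, hz⟩ := WittVector.eq_teichmuller_add_verschiebung y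
  rw [hz]
  simp only [map_add]
  refine add_mem ?_ ?_
  · rw [E.F_d_teichmuller]
    exact E.mul_d_mem_lamDLam _ _ _
  · rw [← E.V_lam, E.F_d_V]
    exact E.d_lam_mem_lamDLam _

theorem IsLamDLam.F {n k : ℕ} {x : E.E (n + 1) k} (hx : E.IsLamDLam (n + 1) k x) :
    E.IsLamDLam n k (E.F x) := by
  match k with
  | 0 =>
    obtain ⟨x, rfl⟩ := hx
    obtain ⟨x, rfl⟩ := WittVector.truncate_surjective p (n + 1) A x
    exact ⟨_, (E.F_lam n x).symm⟩
  | 1 =>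
    refine E.lamDLam_le_comap E.F (fun x y => ?_) hx
    obtain ⟨x, rfl⟩ := WittVector.truncate_surjective p (n + 1) A x
    rw [E.F_mul, E.F_lam]
    exact E.lam_mul_mem_lamDLam _ _ (E.F_d_lam_mem_lamDLam y)
  | _ + 2 => trivial

/-- The formula `V (x dy) = V x * d (V y)`. -/
theorem V_mul_d {n : ℕ} (x y : E.E n 0) :
    E.V (E.mul (Nat.zero_add 1) x (E.d y)) = E.mul (Nat.zero_add 1) (E.V x) (E.d (E.V y)) := by
  have h := E.mul_comm (Nat.zero_add 1) (Nat.add_zero 1) x (E.d y)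
  have h' := E.mul_comm (Nat.zero_add 1) (Nat.add_zero 1) (E.V x) (E.d (E.V y))
  rw [Nat.zero_mul, pow_zero, one_smul] at h h'
  -- With the differentials moved to the left, this is `V (F u * x) = u * V x` for `u = d (V y)`,
  -- since `F u = d y`.
  rw [h, h', ← E.V_F_mul, E.F_d_V]

theorem IsLamDLam.V {n k : ℕ} {x : E.E n k} (hx : E.IsLamDLam n k x) :
    E.IsLamDLam (n + 1) k (E.V x) := by
  match k with
  | 0 =>
    obtain ⟨x, rfl⟩ := hx
    obtain ⟨x, rfl⟩ := WittVector.truncate_surjective p n A x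
    exact ⟨_, (E.V_lam n x).symm⟩
  | 1 =>
    refine E.lamDLam_le_comap E.V (fun x y => ?_) hx
    obtain ⟨x, rfl⟩ := WittVector.truncate_surjective p n A x
    obtain ⟨y, rfl⟩ := WittVector.truncate_surjective p n A y
    rw [E.V_mul_d, E.V_lam, E.V_lam]
    exact E.mul_d_mem_lamDLam _ _ _
  | _ + 2 => trivial

/-- `ofKaehler` is the additive map underlying an `A`-linear one, for the structure `moduleOne`,
which has to be made available locally. -/
theorem ofKaehler_smul (a : A) (ω : Ω[A⁄ℤ]) :
    E.ofKaehler (a • ω)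
      = E.mul (Nat.zero_add 1) (E.lam 1 (wittOne p A a)) (E.ofKaehler ω) :=
  let _ := E.moduleOne
  LinearMap.map_smul (Derivation.liftKaehlerDifferential _) a ω

theorem ofKaehler_D (b : A) :
    E.ofKaehler (KaehlerDifferential.D ℤ A b) = E.d (E.lam 1 (wittOne p A b)) :=
  let _ := E.moduleOne
  Derivation.liftKaehlerDifferential_comp_D _ b

end WittComplex

/-! ### The identification of `Ω¹` with `W₁Ω¹`: surjectivity -/

namespace DeRhamWitt

variable {p : ℕ} [Fact p.Prime] {A : Type u} [CommRing A]

/-- Every element is the class of a formal expression, and each operation preserves the predicate.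
Structural induction runs through all levels and degrees at once, which is why the predicate is
defined in every degree. -/
theorem isLamDLam {n k : ℕ} (x : (deRhamWitt p A).E n k) :
    (deRhamWitt p A).IsLamDLam n k x := by
  obtain ⟨x, rfl⟩ := cls_surj x
  induction x with
  | zero n k => exact (deRhamWitt p A).isLamDLam_zero n k
  | add x y ihx ihy => exact ihx.add _ ihy
  | neg x ih => exact ih.neg _
  | mul h x y ihx ihy => exact ihx.mul _ h ihy
  | d x ih => exact ih.d _
  | R x ih => exact ih.R _
  | lam n x => exact ⟨x, rfl⟩
  | F x ih => exact ih.F _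
  | V x ih => exact ih.V _

theorem ofKaehler_surjective : Function.Surjective (deRhamWitt p A).ofKaehler := by
  intro z
  have hz : z ∈ (deRhamWitt p A).lamDLam 1 := isLamDLam z
  refine (AddSubgroup.closure_le (deRhamWitt p A).ofKaehler.range).2 ?_ hz
  rintro _ ⟨x, y, rfl⟩
  obtain ⟨a, rfl⟩ := (wittOne_bijective p A).2 x
  obtain ⟨b, rfl⟩ := (wittOne_bijective p A).2 y
  exact ⟨a • KaehlerDifferential.D ℤ A b,
    by rw [WittComplex.ofKaehler_smul, WittComplex.ofKaehler_D]⟩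

/-! ### Naturality of the sequence in the ring -/

variable {B : Type v} [CommRing B] [Algebra A B]

theorem truncatedWittMap_wittOne (a : A) :
    truncatedWittMap p A B 1 (wittOne p A a) = wittOne p B (algebraMap A B a) := by
  refine (truncatedWittMap_truncate p A B 1 (WittVector.teichmuller p a)).trans ?_
  rw [WittVector.map_teichmuller]
  rfl

/-- Restricting a Witt complex from `B` to `A` changes only `lam`, by precomposition with
`truncatedWittMap`. Hence this compatibility and the next ones are fields of the morphism `lift`. -/
theorem deRhamWittMap_lam (n : ℕ) (x : TruncatedWittVector p n A) :
    deRhamWittMap p A B n 0 ((deRhamWitt p A).lam n x)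
      = (deRhamWitt p B).lam n (truncatedWittMap p A B n x) :=
  (lift ((deRhamWitt p B).restrict A)).map_lam n x

theorem deRhamWittMap_d {n k : ℕ} (x : (deRhamWitt p A).E n k) :
    deRhamWittMap p A B n (k + 1) ((deRhamWitt p A).d x)
      = (deRhamWitt p B).d (deRhamWittMap p A B n k x) :=
  (lift ((deRhamWitt p B).restrict A)).map_d x

theorem deRhamWittMap_mul {n i j k : ℕ} (h : i + j = k) (x : (deRhamWitt p A).E n i)
    (y : (deRhamWitt p A).E n j) :
    deRhamWittMap p A B n k ((deRhamWitt p A).mul h x y)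
      = (deRhamWitt p B).mul h (deRhamWittMap p A B n i x) (deRhamWittMap p A B n j y) :=
  (lift ((deRhamWitt p B).restrict A)).map_mul h x y

theorem deRhamWittMap_R {n k : ℕ} (x : (deRhamWitt p A).E (n + 1) k) :
    deRhamWittMap p A B n k ((deRhamWitt p A).R x)
      = (deRhamWitt p B).R (deRhamWittMap p A B (n + 1) k x) :=
  (lift ((deRhamWitt p B).restrict A)).map_R x

theorem deRhamWittMap_V {n k : ℕ} (x : (deRhamWitt p A).E n k) :
    deRhamWittMap p A B (n + 1) k ((deRhamWitt p A).V x)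
      = (deRhamWitt p B).V (deRhamWittMap p A B n k x) :=
  (lift ((deRhamWitt p B).restrict A)).map_V x

theorem deRhamWittMap_iterV (k n : ℕ) (x : (deRhamWitt p A).E 1 k) :
    deRhamWittMap p A B (n + 1) k ((deRhamWitt p A).iterV k n x)
      = (deRhamWitt p B).iterV k n (deRhamWittMap p A B 1 k x) := by
  induction n with
  | zero => rfl
  | succ n ih => exact (deRhamWittMap_V _).trans (congrArg (deRhamWitt p B).V ih)

/-- Both sides are semilinear over `A → B`, so it suffices to compare them on the differentials
`db`, which span `Ω¹_A`. -/
theorem deRhamWittMap_ofKaehler (ω : Ω[A⁄ℤ]) :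
    deRhamWittMap p A B 1 1 ((deRhamWitt p A).ofKaehler ω)
      = (deRhamWitt p B).ofKaehler (KaehlerDifferential.map ℤ ℤ A B ω) := by
  have hω : ω ∈ Submodule.span A (Set.range (KaehlerDifferential.D ℤ A)) := by
    rw [KaehlerDifferential.span_range_derivation]
    trivial
  induction hω using Submodule.span_induction with
  | mem x h =>
    obtain ⟨b, rfl⟩ := h
    rw [WittComplex.ofKaehler_D, deRhamWittMap_d, deRhamWittMap_lam, truncatedWittMap_wittOne,
      KaehlerDifferential.map_D, WittComplex.ofKaehler_D]
  | zero => simp only [map_zero]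
  | add x y _ _ hx hy => simp only [map_add, hx, hy]
  | smul a x _ hx =>
    rw [WittComplex.ofKaehler_smul, deRhamWittMap_mul, deRhamWittMap_lam,
      truncatedWittMap_wittOne, hx, map_smul, ← algebraMap_smul B a, WittComplex.ofKaehler_smul]

theorem deRhamWittMap_seqMiddle (n : ℕ) (ω : Ω[A⁄ℤ]) (a : A) :
    deRhamWittMap p A B (n + 1) 1 (seqMiddle p A n (ω, a))
      = seqMiddle p B n (KaehlerDifferential.map ℤ ℤ A B ω, algebraMap A B a) := by
  change deRhamWittMap p A B (n + 1) 1
      ((deRhamWitt p A).iterV 1 n ((deRhamWitt p A).ofKaehler ω)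
        + (deRhamWitt p A).d
          ((deRhamWitt p A).iterV 0 n ((deRhamWitt p A).lam 1 (wittOne p A a))))
    = (deRhamWitt p B).iterV 1 n
        ((deRhamWitt p B).ofKaehler (KaehlerDifferential.map ℤ ℤ A B ω))
      + (deRhamWitt p B).d
        ((deRhamWitt p B).iterV 0 n ((deRhamWitt p B).lam 1 (wittOne p B (algebraMap A B a))))
  rw [map_add, deRhamWittMap_iterV, deRhamWittMap_ofKaehler, deRhamWittMap_d,
    deRhamWittMap_iterV, deRhamWittMap_lam, truncatedWittMap_wittOne]

/-- If `p` is not a zero divisor and the sequence is exact at `Ω¹ ⊕ A`, then `Ω¹ → W₁Ω¹` is injective. -/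
theorem ofKaehler_injective (hA : ∀ a : A, (p : A) * a = 0 → a = 0) {n : ℕ}
    (h : Function.Exact (seqLeft p A n) (seqMiddle p A n)) :
    Function.Injective (deRhamWitt p A).ofKaehler := by
  rw [injective_iff_map_eq_zero]
  intro ω hω
  -- Pairing `ω` with `0` forces the preimage `a` under `(-d, p^n)` to satisfy `p^n a = 0`, so `a =
  -- 0` and `ω = -da = 0`.
  have h0 : seqMiddle p A n (ω, 0) = 0 := by
    change (deRhamWitt p A).iterV 1 n ((deRhamWitt p A).ofKaehler ω)
      + (deRhamWitt p A).d
        ((deRhamWitt p A).iterV 0 n ((deRhamWitt p A).lam 1 (wittOne p A 0))) = 0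
    simp only [hω, map_zero, add_zero]
  obtain ⟨a, ha⟩ := (h _).1 h0
  rw [seqLeft_apply, Prod.mk.injEq] at ha
  rw [← ha.1, eq_zero_of_pow_mul_eq_zero hA n ha.2, map_zero, neg_zero]

end DeRhamWitt

/-! ### The induction on the length -/

theorem mainTheorem10 (p : ℕ) [Fact p.Prime] (hp : p ≠ 2)
    (A : Type u) [CommRing A] (B : Type v) [CommRing B] [Algebra A B]
    (hAB : Function.Injective (algebraMap A B))
    (hA : ∀ a : A, (p : A) * a = 0 → a = 0)
    (hB : ∀ b : B, (p : B) * b = 0 → b = 0)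
    (hint : ∀ n : ℕ, 1 ≤ n →
      (Ideal.span {(p : B) ^ n}).comap (algebraMap A B) = Ideal.span {(p : A) ^ n})
    (hexact : ∀ n : ℕ, 1 ≤ n → SequenceExact p A n ∧ SequenceExact p B n)
    (hΩ : Function.Injective (KaehlerDifferential.map ℤ ℤ A B)) :
    ∀ n : ℕ, 1 ≤ n → Function.Injective (deRhamWittMap p A B n 1) := by
  intro n hn
  induction n, hn using Nat.le_induction with
  | base =>
    rw [injective_iff_map_eq_zero]
    intro x hx
    obtain ⟨ω, rfl⟩ := DeRhamWitt.ofKaehler_surjective x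
    rw [DeRhamWitt.deRhamWittMap_ofKaehler] at hx
    have hω := (injective_iff_map_eq_zero _).1
      (DeRhamWitt.ofKaehler_injective hB (hexact 1 le_rfl).2.exact_left) _ hx
    rw [(injective_iff_map_eq_zero _).1 hΩ ω hω, map_zero]
  | succ n hn ih =>
    rw [injective_iff_map_eq_zero]
    intro x hx
    obtain ⟨hEA, hEB⟩ := hexact n hn
    have hR : (deRhamWitt p A).R x = 0 :=
      (injective_iff_map_eq_zero _).1 ih _ (by rw [DeRhamWitt.deRhamWittMap_R, hx, map_zero])
    obtain ⟨⟨ω, a⟩, rfl⟩ := (hEA.exact_right x).1 hR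
    rw [DeRhamWitt.deRhamWittMap_seqMiddle] at hx
    obtain ⟨b, hb⟩ := (hEB.exact_left _).1 hx
    rw [seqLeft_apply, Prod.mk.injEq] at hb
    -- The second component of `hb` says that the image of `a` is `p^n b`; the intersection
    -- hypothesis descends this divisibility to `A`.
    have ha : a ∈ Ideal.span {(p : A) ^ n} := by
      rw [← hint n hn, Ideal.mem_comap, Ideal.mem_span_singleton']
      exact ⟨b, by rw [mul_comm, hb.2]⟩
    obtain ⟨c, rfl⟩ := Ideal.mem_span_singleton'.1 ha
    -- Both `b` and the image of `c` give the image of `a` when multiplied by `p^n`, which is not a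
    -- zero divisor in `B`.
    have hbc : b = algebraMap A B c := by
      refine sub_eq_zero.1 (eq_zero_of_pow_mul_eq_zero hB n ?_)
      rw [mul_sub, hb.2, map_mul, map_pow, map_natCast, mul_comm, sub_self]
    refine (hEA.exact_left _).2 ⟨c, ?_⟩
    rw [seqLeft_apply, mul_comm, Prod.mk.injEq]
    -- The equality `-dc = ω` is checked in `Ω¹_B`, where it is the first component of `hb`.
    refine ⟨hΩ ?_, rfl⟩
    rw [map_neg, KaehlerDifferential.map_D, ← hbc, hb.1]
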